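/- **Setting.** Let $\mathcal A$ be a finite class (up to isomorphism) of finite similar idempotent smooth algebras closed under subalgebras and homomorphic images, and let $h$ be a ternary term that is an affine operation on $\mathsf{Sg}(a,b)/\theta$ for every affine edge $ab$ (with witness $\theta$) of every algebra of $\mathcal A$. Here, for a maximal congruence $\theta$ of $\mathsf{Sg}(a,b)$: $ab$ is a semilattice edge (witnessed by $\theta$) if some binary term operation is a semilattice operation on $\{a/\theta,b/\theta\}$; a majority edge if some ternary term operation is a majority operation on $\{a/\theta,b/\theta\}$ and no term operation is a semilattice operation there; an affine edge if $\mathsf{Sg}(a,b)/\theta$ is the full idempotent reduct of a module and some term operation is $x-y+z$ on it. An algebra is smooth if $a/\theta\cup b/\theta$ is a subuniverse for every semilattice or majority edge $ab$ with witness $\theta$. In an algebra of the same signature, a pair $ab$ is a thin edge if one of the following holds: (i) $t(a,b)=t(b,a)=b$ for some binary term $t$; (ii) $b$ belongs to $\mathsf{Sg}(a,g(a,b,b))$, $\mathsf{Sg}(a,g(b,a,b))$ and $\mathsf{Sg}(a,g(b,b,a))$ for every ternary term $g$ that is a majority operation on $\{c/\theta,d/\theta\}$ for all majority edges $cd$ of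 algebras of $\mathcal A$; (iii) $h(b,a,a)=b$, and $b\in\mathsf{Sg}(a,h'(a,a,b))$ for every ternary term $h'$ that is a Mal'tsev operation on $\{c/\theta,d/\theta\}$ for all affine edges $cd$ of algebras of $\mathcal A$. For a subuniverse $D$, $\mathsf{umax}(D)$ is the set of $a\in D$ such that every $b\in D$ reachable from $a$ by a directed path of thin edges in $D$ has such a path back to $a$. **Chaining.** Let $R$ be a subdirect product of $\mathbb A_1,\dots,\mathbb A_n$. Unary polynomials of $R$ act on every projection $\mathrm{pr}_IR$ and every $\mathbb A_j$. For a set $\mathcal U$ of unary polynomials of $R$, congruences $\alpha\le\beta$ of $\mathrm{pr}_IR$ and a subuniverse $D$ of $\mathrm{pr}_IR$, call $\alpha,\beta$ *$\mathcal U$-chained with respect to $D$* if for all $a,b\in D$ such that $\beta$ is the congruence generated by $\alpha\cup\{(a,b)\}$, and every $\beta$-block $B$ with $B\cap\mathsf{umax}(D)\neq\emptyset$, the set $(\mathsf{umax}(B\cap D))^2$ is contained in the transitive-symmetric closure of $\alpha\cup\{(f(c),f(d)) : f\in\mathcal U,\ (c,d)\in\alpha\cup\{(a,b)\}\}$. For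 congruences $\beta_i$ of $\mathbb A_i$ and $\beta_i$-blocks $B_i$ put $\overline B=\prod_i B_i$, $\overline\beta_I=\prod_{i\in I}\beta_i$. A polynomial $f$ is $\overline B$-preserving if $f(\overline B)\subseteq\overline B$. The relation $R$ is *chained with respect to $\overline\beta,\overline B$* if for every $I\subseteq[n]$: (Q1) all congruences $\alpha\le\beta\le\overline\beta_I$ of $\mathrm{pr}_IR$ are $\mathcal U$-chained with respect to $\mathrm{pr}_I(R\cap\overline B)$, where $\mathcal U$ is the set of all $\overline B$-preserving unary polynomials of $R$; (Q2) for all congruences $\alpha\prec\beta\le\overline\beta_I$ of $\mathrm{pr}_IR$ and $\gamma\prec\delta\le\beta_j$ of $\mathbb A_j$, $j\in[n]$, such that some unary polynomial $f$ of $R$ satisfies $f(\beta)\not\subseteq\alpha$ and $f(\delta)\subseteq\gamma$, the congruences $\alpha,\beta$ are $\mathcal U$-chained with respect to $\mathrm{pr}_I(R\cap\overline B)$, where $\mathcal U$ is the set of all $\overline B$-preserving unary polynomials $g$ of $R$ with $g(\delta)\subseteq\gamma$. **Lemma.** Let $R$ be a subdirect product of algebras $\mathbb A_1,\dots,\mathbb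 A_n\in\mathcal A$, and for each $i$ let $\beta_i=\underline 1_i$ be the full congruence of $\mathbb A_i$ and $B_i=\mathbb A_i$. Then $R$ is chained with respect to $\overline\beta,\overline B$. -/

import Mathlib

open FirstOrder FirstOrder.Language CategoryTheory

universe u v w

namespace SubdirectChain

/-! Universal algebras are first-order structures of a language without relation symbols, and
term operations are the functions `Term.realize`. -/

section Algebras

variable {L : FirstOrder.Language.{u, v}}

/-- The direct product of a family of algebras, with componentwise operations. -/
instance piStructure {ι : Type*} (A : ι → Type*) [∀ i, L.Structure (A i)] :
    L.Structure (∀ i, A i) where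
  funMap f x i := Structure.funMap f fun j => x j i
  RelMap r x := ∀ i, Structure.RelMap r fun j => x j i

/-- Value of a binary term operation. -/
def op2 {A : Type*} [L.Structure A] (t : L.Term (Fin 2)) (x y : A) : A := t.realize ![x, y]

/-- Value of a ternary term operation. -/
def op3 {A : Type*} [L.Structure A] (t : L.Term (Fin 3)) (x y z : A) : A := t.realize ![x, y, z]

/-- Every basic operation of the algebra is idempotent. -/
def IsIdempotent (L : FirstOrder.Language.{u, v}) (A : Type*) [L.Structure A] : Prop :=
  ∀ (n : ℕ) (f : L.Functions n) (x : A), Structure.funMap f (fun _ => x) = x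

/-- Congruences of an algebra. -/
structure Cong (L : FirstOrder.Language.{u, v}) (A : Type*) [L.Structure A] extends Setoid A where
  compat : ∀ {n : ℕ} (f : L.Functions n) (x y : Fin n → A),
    (∀ i, toSetoid (x i) (y i)) → toSetoid (Structure.funMap f x) (Structure.funMap f y)

namespace Cong

variable {A : Type*} [L.Structure A]

/-- The pair `(x, y)` belongs to the congruence. -/
def Rel (θ : Cong L A) (x y : A) : Prop := θ.toSetoid x y

theorem toSetoid_injective : Function.Injective (Cong.toSetoid : Cong L A → Setoid A) := by
  rintro ⟨s, _⟩ ⟨t, _⟩ h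
  cases h
  rfl

/-- Congruences are ordered by inclusion. -/
instance : PartialOrder (Cong L A) := PartialOrder.lift Cong.toSetoid toSetoid_injective

/-- The greatest element is the full congruence. -/
instance : OrderTop (Cong L A) where
  top := { toSetoid := ⊤, compat := fun _ _ _ _ => trivial }
  le_top θ := (le_top : θ.toSetoid ≤ ⊤)

/-- `β` is the congruence generated by `α ∪ {(a, b)}`. -/
def GeneratedOver (β α : Cong L A) (a b : A) : Prop :=
  IsLeast {θ : Cong L A | α ≤ θ ∧ θ.Rel a b} β

/-- `B` is a block of the congruence. -/
def IsBlock (θ : Cong L A) (B : Set A) : Prop := ∃ b, B = {x | θ.Rel x b}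

end Cong

end Algebras

section Edges

variable {L : FirstOrder.Language.{u, v}} {A : Type w} [L.Structure A]

/-- The subalgebra generated by `a` and `b`. -/
abbrev Sg (L : FirstOrder.Language.{u, v}) {A : Type w} [L.Structure A] (a b : A) : L.Substructure A :=
  Substructure.closure L {a, b}

/-- `a` as an element of `Sg a b`. -/
def fstGen (L : FirstOrder.Language.{u, v}) {A : Type w} [L.Structure A] (a b : A) : Sg L a b :=
  ⟨a, Substructure.subset_closure (by simp)⟩

/-- `b` as an element of `Sg a b`. -/
def sndGen (L : FirstOrder.Language.{u, v}) {A : Type w} [L.Structure A] (a b : A) : Sg L a b :=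
  ⟨b, Substructure.subset_closure (by simp)⟩

/-- The term `t` acts as a semilattice operation on the pair of blocks `{x/θ, y/θ}`. -/
def SemilatticeOn (θ : Cong L A) (t : L.Term (Fin 2)) (x y : A) : Prop :=
  θ.Rel (op2 t x x) x ∧ θ.Rel (op2 t y y) y ∧ θ.Rel (op2 t x y) (op2 t y x) ∧
    (θ.Rel (op2 t x y) x ∨ θ.Rel (op2 t x y) y)

/-- The term `t` acts as a majority operation on the pair of blocks `{x/θ, y/θ}`. -/
def MajorityOn (θ : Cong L A) (t : L.Term (Fin 3)) (x y : A) : Prop :=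
  ∀ p ∈ ({x, y} : Set A), ∀ q ∈ ({x, y} : Set A),
    θ.Rel (op3 t p p q) p ∧ θ.Rel (op3 t p q p) p ∧ θ.Rel (op3 t q p p) p

/-- The term `t` acts as a Mal'tsev operation on the pair of blocks `{x/θ, y/θ}`. -/
def MaltsevOn (θ : Cong L A) (t : L.Term (Fin 3)) (x y : A) : Prop :=
  ∀ p ∈ ({x, y} : Set A), ∀ q ∈ ({x, y} : Set A),
    θ.Rel (op3 t p q q) p ∧ θ.Rel (op3 t q q p) p

/-- The quotient of the algebra by `θ` is (the full idempotent reduct of) a `K`-module `M`,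
where `φ` is the quotient map: the term operations of the quotient are exactly the idempotent
linear operations of the module. -/
def IsModuleQuotient (θ : Cong L A) (K : Type w) [Ring K] (M : Type w) [AddCommGroup M]
    [Module K M] (φ : A → M) : Prop :=
  Function.Surjective φ ∧ (∀ x y, φ x = φ y ↔ θ.Rel x y) ∧
  (∀ (k : ℕ) (t : L.Term (Fin k)), ∃ r : Fin k → K, ∑ i, r i = 1 ∧
    ∀ x : Fin k → A, φ (t.realize x) = ∑ i, r i • φ (x i)) ∧
  (∀ (k : ℕ) (r : Fin k → K), ∑ i, r i = 1 → ∃ t : L.Term (Fin k),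
    ∀ x : Fin k → A, φ (t.realize x) = ∑ i, r i • φ (x i))

/-- The quotient of the algebra by `θ` is a module on which the term `t` acts as `x - y + z`. -/
def AffineOn (θ : Cong L A) (t : L.Term (Fin 3)) : Prop :=
  ∃ (K : Type w) (_ : Ring K) (M : Type w) (_ : AddCommGroup M) (_ : Module K M) (φ : A → M),
    IsModuleQuotient θ K M φ ∧ ∀ x y z, φ (op3 t x y z) = φ x - φ y + φ z

/-- `ab` is a semilattice edge, as witnessed by the maximal congruence `θ` of `Sg a b`. -/
def IsSemilatticeEdge (a b : A) (θ : Cong L (Sg L a b)) : Prop :=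
  IsCoatom θ ∧ ∃ t, SemilatticeOn θ t (fstGen L a b) (sndGen L a b)

/-- `ab` is a majority edge, as witnessed by the maximal congruence `θ` of `Sg a b`. -/
def IsMajorityEdge (a b : A) (θ : Cong L (Sg L a b)) : Prop :=
  IsCoatom θ ∧ (∃ t, MajorityOn θ t (fstGen L a b) (sndGen L a b)) ∧
    ¬ ∃ t, SemilatticeOn θ t (fstGen L a b) (sndGen L a b)

/-- `ab` is an affine edge, as witnessed by the maximal congruence `θ` of `Sg a b`. -/
def IsAffineEdge (a b : A) (θ : Cong L (Sg L a b)) : Prop :=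
  IsCoatom θ ∧ ∃ t, AffineOn θ t

/-- An algebra is smooth if `a/θ ∪ b/θ` is a subuniverse for every semilattice or majority edge
`ab` with witness `θ`. -/
def IsSmooth (L : FirstOrder.Language.{u, v}) (A : Type w) [L.Structure A] : Prop :=
  ∀ (a b : A) (θ : Cong L (Sg L a b)), IsSemilatticeEdge a b θ ∨ IsMajorityEdge a b θ →
    ∀ (n : ℕ) (f : L.Functions n) (x : Fin n → Sg L a b),
      (∀ i, θ.Rel (x i) (fstGen L a b) ∨ θ.Rel (x i) (sndGen L a b)) →
      (θ.Rel (Structure.funMap f x) (fstGen L a b) ∨ θ.Rel (Structure.funMap f x) (sndGen L a b))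

end Edges

section Classes

variable {L : FirstOrder.Language.{u, v}}

/-- A finite class (up to isomorphism) of finite smooth idempotent algebras, closed under taking
subalgebras and homomorphic images. -/
structure IsSmoothClass (𝒜 : Set (Bundled.{w} L.Structure)) : Prop where
  finite : ∀ M ∈ 𝒜, Finite M
  nonempty : ∀ M ∈ 𝒜, Nonempty M
  idempotent : ∀ M ∈ 𝒜, IsIdempotent L M
  smooth : ∀ M ∈ 𝒜, IsSmooth L M
  subalgebra : ∀ M ∈ 𝒜, ∀ S : L.Substructure M, (S : Set M).Nonempty →
    (⟨S, inferInstance⟩ : Bundled.{w} L.Structure) ∈ 𝒜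
  image : ∀ M ∈ 𝒜, ∀ (N : Bundled.{w} L.Structure) (φ : M →[L] N),
    Function.Surjective φ → N ∈ 𝒜
  finitely_many : ∃ F : Set (Bundled.{w} L.Structure), F.Finite ∧
    ∀ M ∈ 𝒜, ∃ N ∈ F, Nonempty (M ≃[L] N)

/-- The term `h` is an affine operation on `Sg a b / θ` for every affine edge `ab`, with witness
`θ`, of every algebra of the class. -/
def IsUniformAffine (𝒜 : Set (Bundled.{w} L.Structure)) (h : L.Term (Fin 3)) : Prop :=
  ∀ M ∈ 𝒜, ∀ (a b : M) (θ : Cong L (Sg L a b)), IsAffineEdge a b θ → AffineOn θ h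

/-- The term `g` is a majority operation on every thick majority edge of the class. -/
def MajorityCondition (𝒜 : Set (Bundled.{w} L.Structure)) (g : L.Term (Fin 3)) : Prop :=
  ∀ M ∈ 𝒜, ∀ (a b : M) (θ : Cong L (Sg L a b)), IsMajorityEdge a b θ →
    MajorityOn θ g (fstGen L a b) (sndGen L a b)

/-- The term `h` is a Mal'tsev operation on every thick affine edge of the class. -/
def MinorityCondition (𝒜 : Set (Bundled.{w} L.Structure)) (h : L.Term (Fin 3)) : Prop :=
  ∀ M ∈ 𝒜, ∀ (a b : M) (θ : Cong L (Sg L a b)), IsAffineEdge a b θ →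
    MaltsevOn θ h (fstGen L a b) (sndGen L a b)

variable {A : Type w} [L.Structure A]

/-- Thin semilattice edges. -/
def ThinSemilattice (L : FirstOrder.Language.{u, v}) {A : Type w} [L.Structure A] (a b : A) : Prop :=
  ∃ t : L.Term (Fin 2), op2 t a b = b ∧ op2 t b a = b

/-- Thin majority edges, relative to the class. -/
def ThinMajority (𝒜 : Set (Bundled.{w} L.Structure)) (a b : A) : Prop :=
  ∀ g : L.Term (Fin 3), MajorityCondition 𝒜 g →
    b ∈ Sg L a (op3 g a b b) ∧ b ∈ Sg L a (op3 g b a b) ∧ b ∈ Sg L a (op3 g b b a)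

/-- Thin affine edges, relative to the class and its fixed affine term `h`. -/
def ThinAffine (𝒜 : Set (Bundled.{w} L.Structure)) (h : L.Term (Fin 3)) (a b : A) : Prop :=
  op3 h b a a = b ∧
    ∀ h' : L.Term (Fin 3), MinorityCondition 𝒜 h' → b ∈ Sg L a (op3 h' a a b)

/-- Thin edges (of any of the three types); they are directed from `a` to `b`. -/
def ThinEdge (𝒜 : Set (Bundled.{w} L.Structure)) (h : L.Term (Fin 3)) (a b : A) : Prop :=
  ThinSemilattice L a b ∨ ThinMajority 𝒜 a b ∨ ThinAffine 𝒜 h a b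

/-- There is a path of thin edges from `a` to `b` inside `D`. -/
def Connected (𝒜 : Set (Bundled.{w} L.Structure)) (h : L.Term (Fin 3)) (D : Set A) (a b : A) :
    Prop :=
  Relation.ReflTransGen (fun x y => x ∈ D ∧ y ∈ D ∧ ThinEdge 𝒜 h x y) a b

/-- The u-maximal elements of a subuniverse `D` of `A`. Being a thin edge depends only on the
values of term operations at `a`, `b`, so the thin edges of the algebra `D` are those of `A` with
both ends in `D`. -/
def umax (𝒜 : Set (Bundled.{w} L.Structure)) (h : L.Term (Fin 3)) (D : Set A) : Set A :=
  {a | a ∈ D ∧ ∀ b, Connected 𝒜 h D a b → Connected 𝒜 h D b a}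

end Classes

section Polynomials

variable {L : FirstOrder.Language.{u, v}} {R P Q : Type*} [L.Structure R] [L.Structure P] [L.Structure Q]

/-- Unary polynomials of the algebra `R`: terms in one variable with constants from `R`. -/
abbrev UPoly (L : FirstOrder.Language.{u, v}) (R : Type*) : Type _ := L.Term (R ⊕ Unit)

/-- The action of a unary polynomial of `R` on an algebra `P` to which `R` is mapped by a
homomorphism (in the applications, a projection of `R`): constants are replaced by their
images. -/
def act (φ : R →[L] P) (f : UPoly L R) (x : P) : P := f.realize (Sum.elim φ fun _ => x)

/-- `f(β) ⊆ α`. -/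
def Collapses (φ : R →[L] P) (f : UPoly L R) (β α : Cong L P) : Prop :=
  ∀ x y, β.Rel x y → α.Rel (act φ f x) (act φ f y)

/-- The interval `(α, β)` can be separated from `(γ, δ)` by a unary polynomial of `R`. -/
def CanSeparate (φ : R →[L] P) (α β : Cong L P) (ψ : R →[L] Q) (γ δ : Cong L Q) : Prop :=
  ∃ f : UPoly L R, ¬ Collapses φ f β α ∧ Collapses ψ f δ γ

/-- `T(X, 𝒰)`: the images of the pairs from `X` under the polynomials from `𝒰`. -/
def images (φ : R →[L] P) (𝒰 : Set (UPoly L R)) (X : Set (P × P)) : Set (P × P) :=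
  {p | ∃ f ∈ 𝒰, ∃ q ∈ X, p = (act φ f q.1, act φ f q.2)}

/-- The transitive-symmetric closure of a set of pairs. -/
def chainClosure (X : Set (P × P)) (x y : P) : Prop :=
  Relation.TransGen (fun p q => (p, q) ∈ X ∨ (q, p) ∈ X) x y

end Polynomials

section Chaining

variable {L : FirstOrder.Language.{u, v}}

/-- `α` and `β` are `𝒰`-chained with respect to the subuniverse `D` of `P`. Chains of images of
pairs are taken modulo `α`, so the pairs of `α` itself may be used as links. -/
def UChained (𝒜 : Set (Bundled.{w} L.Structure)) (h : L.Term (Fin 3))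
    {R P : Type w} [L.Structure R] [L.Structure P] (φ : R →[L] P) (𝒰 : Set (UPoly L R))
    (α β : Cong L P) (D : Set P) : Prop :=
  ∀ a ∈ D, ∀ b ∈ D, β.GeneratedOver α a b →
    ∀ B : Set P, β.IsBlock B → (B ∩ umax 𝒜 h D).Nonempty →
      ∀ x ∈ umax 𝒜 h (B ∩ D), ∀ y ∈ umax 𝒜 h (B ∩ D),
        chainClosure ({p | α.Rel p.1 p.2} ∪
          images φ 𝒰 ({p | α.Rel p.1 p.2} ∪ {(a, b)})) x y

variable {n : ℕ} {A : Fin n → Type w} [∀ i, L.Structure (A i)]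

/-- `R` projects onto every factor. -/
def IsSubdirect (R : L.Substructure (∀ i, A i)) : Prop :=
  ∀ i, ∀ a : A i, ∃ x ∈ R, x i = a

/-- The restriction homomorphism from the full product to the product over `I`. -/
def restrictHom (I : Set (Fin n)) : (∀ i, A i) →[L] (∀ i : I, A i) where
  toFun x i := x i
  map_fun' _ _ := rfl
  map_rel' _ _ hr i := hr i

/-- The projection `pr_I R`, a subalgebra of the product over `I`. -/
abbrev proj (R : L.Substructure (∀ i, A i)) (I : Set (Fin n)) :
    L.Substructure (∀ i : I, A i) :=
  R.map (restrictHom I)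

/-- The projection homomorphism from `R` onto `pr_I R`. -/
def projHom (R : L.Substructure (∀ i, A i)) (I : Set (Fin n)) : R →[L] proj R I :=
  Hom.codRestrict (proj R I) ((restrictHom I).comp R.subtype.toHom)
    fun x => Substructure.mem_map_of_mem _ x.2

/-- The coordinate homomorphism from `R` to the factor `A j`. -/
def coordHom (R : L.Substructure (∀ i, A i)) (j : Fin n) : R →[L] A j where
  toFun x := x.1 j
  map_fun' _ _ := rfl
  map_rel' _ _ hr := hr j

/-- `pr_I (R ∩ ∏ B i)`, as a subset of `pr_I R`. -/
def projBlock (R : L.Substructure (∀ i, A i)) (B : ∀ i, Set (A i)) (I : Set (Fin n)) :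
    Set (proj R I) :=
  {y | ∃ x : R, (∀ i, x.1 i ∈ B i) ∧ projHom R I x = y}

/-- The congruence of `pr_I R` is contained in the product of the congruences `β i`, `i ∈ I`. -/
def LeProd {R : L.Substructure (∀ i, A i)} {I : Set (Fin n)} (θ : Cong L (proj R I))
    (β : ∀ i, Cong L (A i)) : Prop :=
  ∀ x y, θ.Rel x y → ∀ i : I, (β i).Rel (x.1 i) (y.1 i)

/-- The unary polynomials of `R` that preserve the product of the sets `B i`. -/
def preserving (R : L.Substructure (∀ i, A i)) (B : ∀ i, Set (A i)) : Set (UPoly L R) :=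
  {f | ∀ x : ∀ i, A i, (∀ i, x i ∈ B i) → ∀ i, act R.subtype.toHom f x i ∈ B i}

/-- The relation `R` is chained with respect to the congruences `β i` and their blocks `B i`. -/
structure Chained (𝒜 : Set (Bundled.{w} L.Structure)) (h : L.Term (Fin 3))
    (R : L.Substructure (∀ i, A i)) (β : ∀ i, Cong L (A i)) (B : ∀ i, Set (A i)) : Prop where
  q1 : ∀ (I : Set (Fin n)) (α' β' : Cong L (proj R I)), α' ≤ β' → LeProd β' β →
    UChained 𝒜 h (projHom R I) (preserving R B) α' β' (projBlock R B I)
  q2 : ∀ (I : Set (Fin n)) (α' β' : Cong L (proj R I)) (j : Fin n) (γ δ : Cong L (A j)),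
    α' ⋖ β' → LeProd β' β → γ ⋖ δ → δ ≤ β j →
    CanSeparate (projHom R I) α' β' (coordHom R j) γ δ →
    UChained 𝒜 h (projHom R I) {g ∈ preserving R B | Collapses (coordHom R j) g δ γ}
      α' β' (projBlock R B I)

end Chaining

end SubdirectChain

/-!
When every block `B i` is the whole algebra, all unary polynomials of `R` are admissible and chaining
is a statement about congruence generation in the style of Mal'tsev. An equivalence relation on a
homomorphic image `P` of `R` that is preserved by the unary polynomials of `R` is a congruence
(`Cong.ofPreserved`). Hence if `𝒰` absorbs composition on the left with arbitrary polynomials, the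
transitive-symmetric closure of `α` and the `𝒰`-images of `α ∪ {(a, b)}` is a congruence `T`
(`chainCong`) with `α ≤ T`.

* If `𝒰` contains all polynomials, then `T` contains `(a, b)`, so `T` contains the congruence `β`
  generated by `α ∪ {(a, b)}`.
* If `α ⋖ β` and `𝒰` is the set of polynomials collapsing `δ` into `γ`, then `𝒰` is a two-sided
  ideal for composition, so the pairs that every member of `𝒰` sends into `α` also form a congruence.
  It does not contain `β`, because a separating polynomial lies in `𝒰`; hence it omits `(a, b)`, and
  some `g ∈ 𝒰` has `(g a, g b) ∉ α`. Thus `α < T ≤ β`, and so `T = β`.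

In both cases any two elements of a `β`-block are joined by a chain, whether u-maximal or not.
-/

namespace SubdirectChain

section PolynomialCongruences

variable {L : FirstOrder.Language.{u, v}} {R P : Type*} [L.Structure R] [L.Structure P]

/-- The composition `p ∘ q` of unary polynomials. -/
def UPoly.comp (p q : UPoly L R) : UPoly L R :=
  p.subst (Sum.elim (fun r => Term.var (Sum.inl r)) fun _ => q)

theorem act_comp (φ : R →[L] P) (p q : UPoly L R) (x : P) :
    act φ (p.comp q) x = act φ p (act φ q x) := by
  unfold act UPoly.comp
  rw [Term.realize_subst]
  congr 1
  funext i
  cases i <;> rfl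

theorem Cong.act_rel (θ : Cong L P) (φ : R →[L] P) (p : UPoly L R) {x y : P} (hxy : θ.Rel x y) :
    θ.Rel (act φ p x) (act φ p y) := by
  induction p with
  | var i =>
    cases i with
    | inl r => exact θ.refl _
    | inr _ => exact hxy
  | func F ts ih => exact θ.compat F _ _ ih

/-- The translation `x ↦ F (c 0, …, x, …)`, with `x` in position `j`. -/
def translation {n : ℕ} (F : L.Functions n) (j : Fin n) (c : Fin n → R) : UPoly L R :=
  Term.func F (Function.update (fun i => Term.var (Sum.inl (c i))) j (Term.var (Sum.inr ())))

theorem act_translation (φ : R →[L] P) {n : ℕ} (F : L.Functions n) (j : Fin n) (c : Fin n → R)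
    (x : P) :
    act φ (translation F j c) x = Structure.funMap F (Function.update (fun i => φ (c i)) j x) := by
  unfold act translation
  rw [Term.realize_func]
  congr 1
  funext i
  by_cases hij : i = j
  · subst hij
    simp
  · simp [hij]

/-- An equivalence relation preserved by all unary polynomials with constants from `R`, where `R`
is mapped onto `P`, is a congruence of `P`. -/
def Cong.ofPreserved (φ : R →[L] P) (hφ : Function.Surjective φ) (s : Setoid P)
    (hs : ∀ (p : UPoly L R) (x y : P), s x y → s (act φ p x) (act φ p y)) : Cong L P where
  toSetoid := s
  compat {n} F x y hxy := by
    -- Replace the arguments `x i` by `y i` one position at a time.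
    have key : ∀ t : Finset (Fin n),
        s (Structure.funMap F x) (Structure.funMap F (t.piecewise y x)) := by
      intro t
      induction t using Finset.induction_on with
      | empty => simp
      | insert j t hj ih =>
        refine s.trans ih ?_
        choose c hc using fun i => hφ (t.piecewise y x i)
        have h1 := hs (translation F j c) _ _ (hxy j)
        have hx : Function.update (t.piecewise y x) j (x j) = t.piecewise y x := by
          rw [← Finset.piecewise_eq_of_notMem t y x hj, Function.update_eq_self]
        rw [act_translation, act_translation] at h1
        simp only [hc] at h1
        rw [hx] at h1
        rwa [Finset.piecewise_insert]
    simpa only [Finset.piecewise_univ] using key Finset.univ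

variable (φ : R →[L] P) (hφ : Function.Surjective φ) {𝒰 : Set (UPoly L R)}

/-- The chaining relation of `α` and the `𝒰`-images of `α ∪ {(a, b)}`, as a congruence: it is
preserved by polynomials because `𝒰` absorbs them on the left. -/
def chainCong (hl : ∀ p, ∀ g ∈ 𝒰, UPoly.comp p g ∈ 𝒰) (α : Cong L P) (a b : P) : Cong L P :=
  Cong.ofPreserved φ hφ
    { r := chainClosure ({p | α.Rel p.1 p.2} ∪ images φ 𝒰 ({p | α.Rel p.1 p.2} ∪ {(a, b)}))
      iseqv :=
        { refl := fun x => .single (.inl (.inl (α.refl x)))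
          symm := fun hxy => by
            induction hxy with
            | single hc => exact .single hc.symm
            | tail _ hc ih => exact .head hc.symm ih
          trans := fun hxy hyz => Relation.TransGen.trans hxy hyz } }
    (by
      intro p x y hxy
      have hX : ∀ c d : P,
          (c, d) ∈ {p | α.Rel p.1 p.2} ∪ images φ 𝒰 ({p | α.Rel p.1 p.2} ∪ {(a, b)}) →
          (act φ p c, act φ p d) ∈
            {p | α.Rel p.1 p.2} ∪ images φ 𝒰 ({p | α.Rel p.1 p.2} ∪ {(a, b)}) := by
        rintro c d (hcd | ⟨g, hg, q, hq, hcd⟩)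
        · exact .inl (α.act_rel φ p hcd)
        · obtain ⟨rfl, rfl⟩ := Prod.mk.inj hcd
          exact .inr ⟨p.comp g, hl p g hg, q, hq, by rw [act_comp, act_comp]⟩
      induction hxy with
      | single hc => exact .single (hc.imp (hX _ _) (hX _ _))
      | tail _ hc ih => exact .tail ih (hc.imp (hX _ _) (hX _ _)))

/-- The pairs that every polynomial in `𝒰` sends into `α`, as a congruence: it is preserved by
polynomials because `𝒰` absorbs them on the right. -/
def residual (hr : ∀ g ∈ 𝒰, ∀ p, UPoly.comp g p ∈ 𝒰) (α : Cong L P) : Cong L P :=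
  Cong.ofPreserved φ hφ
    { r := fun x y => ∀ g ∈ 𝒰, α.Rel (act φ g x) (act φ g y)
      iseqv :=
        { refl := fun _ _ _ => α.refl _
          symm := fun hxy g hg => α.symm (hxy g hg)
          trans := fun hxy hyz g hg => α.trans (hxy g hg) (hyz g hg) } }
    (by
      intro p x y hxy g hg
      simpa only [act_comp] using hxy _ (hr g hg p))

variable {φ}

theorem le_chainCong (hl : ∀ p, ∀ g ∈ 𝒰, UPoly.comp p g ∈ 𝒰) (α : Cong L P) (a b : P) :
    α ≤ chainCong φ hφ hl α a b :=
  fun _ _ hxy => .single (.inl (.inl hxy))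

theorem chainCong_act (hl : ∀ p, ∀ g ∈ 𝒰, UPoly.comp p g ∈ 𝒰) (α : Cong L P) (a b : P)
    {g : UPoly L R} (hg : g ∈ 𝒰) : (chainCong φ hφ hl α a b).Rel (act φ g a) (act φ g b) :=
  .single (.inl (.inr ⟨g, hg, (a, b), .inr rfl, rfl⟩))

theorem chainCong_le (hl : ∀ p, ∀ g ∈ 𝒰, UPoly.comp p g ∈ 𝒰) {α β : Cong L P} {a b : P}
    (hαβ : α ≤ β) (hab : β.Rel a b) : chainCong φ hφ hl α a b ≤ β := by
  have hX : ∀ c d : P,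
      (c, d) ∈ {p | α.Rel p.1 p.2} ∪ images φ 𝒰 ({p | α.Rel p.1 p.2} ∪ {(a, b)}) →
      β.Rel c d := by
    rintro c d (hcd | ⟨g, -, q, hq, hcd⟩)
    · exact hαβ hcd
    · obtain ⟨rfl, rfl⟩ := Prod.mk.inj hcd
      refine β.act_rel φ g ?_
      rcases hq with hq | rfl
      · exact hαβ hq
      · exact hab
  intro x y hxy
  induction hxy with
  | single hc => exact hc.elim (hX _ _) fun hc' => β.symm (hX _ _ hc')
  | tail _ hc ih => exact β.trans ih (hc.elim (hX _ _) fun hc' => β.symm (hX _ _ hc'))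

/-- Mal'tsev's description of generated congruences, for the set of all polynomials. -/
theorem le_chainCong_of_var_mem (hl : ∀ p, ∀ g ∈ 𝒰, UPoly.comp p g ∈ 𝒰)
    (hvar : Term.var (Sum.inr ()) ∈ 𝒰) {α β : Cong L P} {a b : P}
    (hβ : β.GeneratedOver α a b) : β ≤ chainCong φ hφ hl α a b :=
  hβ.2 ⟨le_chainCong hφ hl α a b, chainCong_act hφ hl α a b hvar⟩

/-- For a prime quotient `α ⋖ β`, a two-sided ideal of polynomials that does not collapse `β`
into `α` already suffices to generate `β`. -/
theorem le_chainCong_of_covBy (hl : ∀ p, ∀ g ∈ 𝒰, UPoly.comp p g ∈ 𝒰)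
    (hr : ∀ g ∈ 𝒰, ∀ p, UPoly.comp g p ∈ 𝒰) {α β : Cong L P} {a b : P} (hαβ : α ⋖ β)
    (hβ : β.GeneratedOver α a b) {f : UPoly L R} (hf : f ∈ 𝒰) (hfβ : ¬ Collapses φ f β α) :
    β ≤ chainCong φ hφ hl α a b := by
  have hT := le_chainCong hφ hl α a b
  have hTβ := chainCong_le hφ hl hαβ.le hβ.1.2
  rcases hαβ.eq_or_eq hT hTβ with heq | heq
  · refine absurd ?_ hfβ
    have hle : β ≤ residual φ hφ hr α := by
      refine hβ.2 ⟨fun x y hxy g _ => α.act_rel φ g hxy, fun g hg => ?_⟩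
      have hgab := chainCong_act hφ hl α a b hg
      rwa [heq] at hgab
    exact fun x y hxy => hle hxy f hf
  · exact heq.ge

end PolynomialCongruences

section Chaining

variable {L : FirstOrder.Language.{u, v}}

theorem uChained_of_le_chainCong (𝒜 : Set (Bundled.{w} L.Structure)) (h : L.Term (Fin 3))
    {R P : Type w} [L.Structure R] [L.Structure P] {φ : R →[L] P} (hφ : Function.Surjective φ)
    {𝒰 : Set (UPoly L R)} (hl : ∀ p, ∀ g ∈ 𝒰, UPoly.comp p g ∈ 𝒰) {α β : Cong L P}
    (hle : ∀ a b, β.GeneratedOver α a b → β ≤ chainCong φ hφ hl α a b) (D : Set P) :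
    UChained 𝒜 h φ 𝒰 α β D := by
  rintro a - b - hβ B ⟨c, rfl⟩ - x hx y hy
  exact hle a b hβ (β.trans hx.1.1 (β.symm hy.1.1))

variable {n : ℕ} {A : Fin n → Type w} [∀ i, L.Structure (A i)]

theorem projHom_surjective (R : L.Substructure (∀ i, A i)) (I : Set (Fin n)) :
    Function.Surjective (projHom R I) := by
  rintro ⟨_, x, hx, rfl⟩
  exact ⟨⟨x, hx⟩, rfl⟩

theorem mem_preserving_univ (R : L.Substructure (∀ i, A i)) (f : UPoly L R) :
    f ∈ preserving R fun _ => Set.univ :=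
  fun _ _ _ => trivial

end Chaining

end SubdirectChain

theorem lemma44 {L : FirstOrder.Language.{u, v}} [L.IsAlgebraic]
    (𝒜 : Set (Bundled.{w} L.Structure)) (h𝒜 : SubdirectChain.IsSmoothClass 𝒜)
    (h : L.Term (Fin 3)) (hh : SubdirectChain.IsUniformAffine 𝒜 h)
    {n : ℕ} (A : Fin n → Type w) [∀ i, L.Structure (A i)]
    (hA : ∀ i, (⟨A i, inferInstance⟩ : Bundled.{w} L.Structure) ∈ 𝒜)
    (R : L.Substructure (∀ i, A i)) (hR : SubdirectChain.IsSubdirect R) :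
    SubdirectChain.Chained 𝒜 h R (fun _ => ⊤) (fun _ => Set.univ) := by
  open SubdirectChain in
  refine ⟨fun I α β _ _ => ?_, fun I α β j γ δ hαβ _ _ _ ⟨f, hfβ, hfδ⟩ => ?_⟩
  · exact uChained_of_le_chainCong 𝒜 h (projHom_surjective R I)
      (fun p g _ => mem_preserving_univ R (p.comp g))
      (fun a b hβ => le_chainCong_of_var_mem _ _ (mem_preserving_univ R _) hβ) _
  · have hl : ∀ p, ∀ g ∈ {g ∈ preserving R fun _ => Set.univ | Collapses (coordHom R j) g δ γ},
        UPoly.comp p g ∈ {g ∈ preserving R fun _ => Set.univ |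
          Collapses (coordHom R j) g δ γ} := by
      refine fun p g hg => ⟨mem_preserving_univ R (p.comp g), fun x y hxy => ?_⟩
      rw [act_comp, act_comp]
      exact γ.act_rel _ p (hg.2 x y hxy)
    have hr : ∀ g ∈ {g ∈ preserving R fun _ => Set.univ | Collapses (coordHom R j) g δ γ}, ∀ p,
        UPoly.comp g p ∈ {g ∈ preserving R fun _ => Set.univ |
          Collapses (coordHom R j) g δ γ} := by
      refine fun g hg p => ⟨mem_preserving_univ R (g.comp p), fun x y hxy => ?_⟩
      rw [act_comp, act_comp]
      exact hg.2 _ _ (δ.act_rel _ p hxy)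
    exact uChained_of_le_chainCong 𝒜 h (projHom_surjective R I) hl
      (fun a b hβ => le_chainCong_of_covBy _ hl hr hαβ hβ
        ⟨mem_preserving_univ R f, hfδ⟩ hfβ) _
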